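/- Let $M$ be a lattice of rank $d$ in a $d$-dimensional real vector space $M_{\mathbb R}$, let $N=\{y\in M_{\mathbb R}^*:\langle x,y\rangle\in\mathbb Z\ \forall x\in M\}$ be the dual lattice in $N_{\mathbb R}=M_{\mathbb R}^*$, and let $P\subseteq M_{\mathbb R}$ be a reflexive polytope, i.e. $P$ is a $d$-dimensional polytope with $0$ in its interior, all vertices of $P$ are primitive points of $M$, and the dual polytope $P^*=\{y\in N_{\mathbb R}:\langle x,y\rangle\ge -1\ \forall x\in P\}$ has all its vertices in $N$. Let $\mathcal V(Q)$ denote the set of vertices and $\mathcal F(Q)$ the set of facets (faces of codimension one, where the empty face has dimension $-1$) of a polytope $Q$, and put $$\alpha:=\max\{|\mathcal V(F)|: F\in\mathcal F(P)\},\qquad \beta:=\max\{|\mathcal F(F)|: F\in\mathcal F(P)\}.$$ 1. $|\mathcal V(P)|\le 2d\alpha$. More precisely: - if $\alpha\ge 2d-3$, then $|\mathcal V(P)|\le 2d(\alpha-d+2)-2$; - if $\alpha\le 2d-3$, then $|\mathcal V(P)|\le d\alpha+\alpha-d+1$. The polytope $P$ is simplicial (every facet is a simplex) if and only if $\alpha=d$;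 if $P$ is simplicial and $d\ge 3$, then $|\mathcal V(P)|\le d^2+1$. 2. $$|\mathcal V(P)|\le(\alpha-d+1)\beta+2+2\sqrt{(\alpha-1)(d+1)\bigl((\alpha-1)+(\alpha-d+1)\beta\bigr)}.$$ If $P$ is simplicial, then $\alpha=\beta=d$ and $$|\mathcal V(P)|\le d+2+2\sqrt{(d^2-1)(2d-1)}.$$ -/

import Mathlib

namespace ReflexivePolytope

section Polytopes

variable {V : Type*} [AddCommGroup V] [Module ℝ V]

/-- A polytope is the convex hull of finitely many points. -/
def IsPolytope (P : Set V) : Prop :=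
  ∃ S : Finset V, P = convexHull ℝ (S : Set V)

/-- The set of vertices of a polytope. -/
def vertices (P : Set V) : Set V :=
  Set.extremePoints ℝ P

open Classical in
/-- The dimension of a polytope; the empty polytope has dimension `-1`. -/
noncomputable def polyDim (P : Set V) : ℤ :=
  if P.Nonempty then (Module.finrank ℝ (vectorSpan ℝ P) : ℤ) else -1

/-- A simplex is the convex hull of finitely many affinely independent points. -/
def IsSimplex (P : Set V) : Prop :=
  ∃ S : Finset V, AffineIndependent ℝ ((↑) : S → V) ∧ P = convexHull ℝ (S : Set V)

/-- A lattice polytope (with respect to the lattice `L`) is a polytope all of whose vertices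
lie in `L`. -/
def IsLatticePolytope (L : Submodule ℤ V) (P : Set V) : Prop :=
  IsPolytope P ∧ vertices P ⊆ (L : Set V)

/-- A primitive lattice point: a point of `L` that is an integral multiple of a lattice point
only for the factors `1` and `-1`. In particular `0` is not primitive. -/
def IsPrimitivePoint (L : Submodule ℤ V) (v : V) : Prop :=
  v ∈ L ∧ ∀ w ∈ L, ∀ k : ℤ, v = k • w → k = 1 ∨ k = -1

variable [TopologicalSpace V]

/-- The facets of a polytope `P`: the faces of dimension `dim P - 1`. The faces of `P` are the
empty set and the sets where a linear functional attains its maximum on `P`; these are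
the sets `F` with `IsExposed ℝ P F`. -/
def facets (P : Set V) : Set (Set V) :=
  {F | IsExposed ℝ P F ∧ polyDim F + 1 = polyDim P}

/-- A polytope is simplicial if every facet is a simplex. -/
def IsSimplicial (P : Set V) : Prop :=
  ∀ F ∈ facets P, IsSimplex F

/-- The maximal number of vertices of a facet of `P`. -/
noncomputable def maxFacetVertices (P : Set V) : ℕ :=
  sSup {n | ∃ F ∈ facets P, n = (vertices F).ncard}

/-- The maximal number of facets of a facet of `P`. -/
noncomputable def maxFacetFacets (P : Set V) : ℕ :=
  sSup {n | ∃ F ∈ facets P, n = (facets F).ncard}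

end Polytopes

section Reflexive

variable {E : Type*} [NormedAddCommGroup E] [NormedSpace ℝ E]

/-- The dual lattice `N` of a lattice `M ⊆ E`: the linear functionals with integral values
on `M`. -/
def dualLattice (M : Submodule ℤ E) : Submodule ℤ (StrongDual ℝ E) where
  carrier := {y | ∀ m ∈ M, ∃ k : ℤ, y m = k}
  zero_mem' := fun m _ => ⟨0, by simp⟩
  add_mem' := by
    intro y z hy hz m hm
    obtain ⟨k, hk⟩ := hy m hm
    obtain ⟨l, hl⟩ := hz m hm
    exact ⟨k + l, by simp [hk, hl]⟩
  smul_mem' := by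
    intro c y hy m hm
    obtain ⟨k, hk⟩ := hy m hm
    exact ⟨c * k, by simp [hk]⟩

/-- The dual polytope `P* = {y | ⟨x, y⟩ ≥ -1 for all x ∈ P}`. -/
def dualPolytope (P : Set E) : Set (StrongDual ℝ E) :=
  {y | ∀ x ∈ P, -1 ≤ y x}

/-- A Fano polytope: a full-dimensional lattice polytope containing the origin in its interior,
all of whose vertices are primitive lattice points. -/
structure IsFano (M : Submodule ℤ E) (P : Set E) : Prop where
  isLatticePolytope : IsLatticePolytope M P
  zero_mem_interior : (0 : E) ∈ interior P
  primitive : ∀ v ∈ vertices P, IsPrimitivePoint M v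

/-- A reflexive polytope: a Fano polytope whose dual is a lattice polytope. -/
structure IsReflexive (M : Submodule ℤ E) (P : Set E) : Prop where
  isFano : IsFano M P
  dual_isLatticePolytope : IsLatticePolytope (dualLattice M) (dualPolytope P)

end Reflexive

end ReflexivePolytope

/-! Facets of `P` correspond to vertices `u` of the dual polytope (`facets_eq_image`), and each such
`u` takes integer values at least `-1` on the vertices of `P`. Since `0` lies in the dual polytope,
some `u` is nonpositive on the sum of all vertices (`exists_vertex_dual_nonpos`). For this special
facet the vertices on positive levels are at most as many as those on level `-1`, so `|V(P)|` is at
most twice the count on level `-1` plus the count on level `0`. Level `-1` contributes at most `α`.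
A nonzero vertex on level `0` is negative for some adjacent facet (`exists_adjacent_neg`), hence
lies on it by integrality. An adjacent facet shares at least `d - 1` vertices with the special one,
leaving at most `α - d + 1` on level `0`. There are at most `β` adjacent facets, and by Steinitz's
theorem `2(d - 1)` of them suffice. Thus `|V(P)|` is at most `2α + 2(d-1)(α-d+1)` and at most `2α +
(α-d+1)β`; every stated bound follows from these by arithmetic. -/

namespace ReflexivePolytope

/-! ### Polytopes, their faces and vertices -/

section General

variable {E : Type*} [NormedAddCommGroup E] [NormedSpace ℝ E]

theorem IsPolytope.finite_vertices {P : Set E} (hP : IsPolytope P) : (vertices P).Finite := by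
  obtain ⟨S, rfl⟩ := hP
  exact S.finite_toSet.subset extremePoints_convexHull_subset

theorem IsPolytope.isCompact {P : Set E} (hP : IsPolytope P) : IsCompact P := by
  obtain ⟨S, rfl⟩ := hP
  exact S.finite_toSet.isCompact_convexHull ℝ

theorem IsPolytope.convex {P : Set E} (hP : IsPolytope P) : Convex ℝ P := by
  obtain ⟨S, rfl⟩ := hP
  exact convex_convexHull ℝ _

theorem convexHull_vertices_of_finite {P : Set E} (hc : IsCompact P) (hconv : Convex ℝ P)
    (hfin : (vertices P).Finite) : convexHull ℝ (vertices P) = P := by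
  have h : closure (convexHull ℝ (vertices P)) = P := closure_convexHull_extremePoints hc hconv
  rwa [(hfin.isCompact_convexHull ℝ).isClosed.closure_eq] at h

theorem IsPolytope.convexHull_vertices {P : Set E} (hP : IsPolytope P) :
    convexHull ℝ (vertices P) = P :=
  convexHull_vertices_of_finite hP.isCompact hP.convex hP.finite_vertices

theorem vertices_of_isExposed {P F : Set E} (hF : IsExposed ℝ P F) :
    vertices F = F ∩ vertices P :=
  hF.isExtreme.extremePoints_eq

theorem IsPolytope.of_isExposed {P F : Set E} (hP : IsPolytope P) (hF : IsExposed ℝ P F) :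
    IsPolytope F := by
  have hfin : (vertices F).Finite := by
    rw [vertices_of_isExposed hF]
    exact hP.finite_vertices.subset Set.inter_subset_right
  refine ⟨hfin.toFinset, ?_⟩
  rw [hfin.coe_toFinset, convexHull_vertices_of_finite (hF.isCompact hP.isCompact)
    (hF.convex hP.convex) hfin]

theorem IsPolytope.span_vertices {P : Set E} (hP : IsPolytope P) :
    Submodule.span ℝ (vertices P) = Submodule.span ℝ P := by
  refine le_antisymm (Submodule.span_mono extremePoints_subset) (Submodule.span_le.2 ?_)
  conv_lhs => rw [← hP.convexHull_vertices]
  exact convexHull_min Submodule.subset_span (Submodule.convex _)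

theorem IsPolytope.finite_facets {P : Set E} (hP : IsPolytope P) : (facets P).Finite := by
  refine Set.Finite.of_finite_image (f := vertices) ?_ ?_
  · refine hP.finite_vertices.finite_subsets.subset ?_
    rintro _ ⟨F, hF, rfl⟩
    show vertices F ⊆ vertices P
    rw [vertices_of_isExposed hF.1]
    exact Set.inter_subset_right
  · intro F hF G hG h
    rw [← (hP.of_isExposed hF.1).convexHull_vertices,
      ← (hP.of_isExposed hG.1).convexHull_vertices]
    exact congrArg _ h

theorem isExposed_sep {P : Set E} (l : StrongDual ℝ E) (c : ℝ) (h : ∀ x ∈ P, c ≤ l x) :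
    IsExposed ℝ P {x ∈ P | l x = c} := by
  rintro ⟨p, hp, hpc⟩
  refine ⟨-l, ?_⟩
  ext x
  simp only [Set.mem_ofPred_eq, neg_apply, neg_le_neg_iff]
  constructor
  · rintro ⟨hx, hxc⟩
    exact ⟨hx, fun y hy => hxc ▸ h y hy⟩
  · rintro ⟨hx, hxm⟩
    exact ⟨hx, le_antisymm (hpc ▸ hxm p hp) (h x hx)⟩

/-- The linear span of a set in an affine hyperplane missing the origin. -/
theorem finrank_span_eq_polyDim_add_one [FiniteDimensional ℝ E] {F : Set E} (u : StrongDual ℝ E)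
    (hu : ∀ x ∈ F, u x = -1) :
    (Module.finrank ℝ (Submodule.span ℝ F) : ℤ) = polyDim F + 1 := by
  unfold polyDim
  split_ifs with hne
  · obtain ⟨p, hp⟩ := hne
    have hker : vectorSpan ℝ F ≤ LinearMap.ker (u : E →ₗ[ℝ] ℝ) := by
      rw [vectorSpan_def, Submodule.span_le]
      rintro _ ⟨a, ha, b, hb, rfl⟩
      simp [hu a ha, hu b hb]
    have hp0 : p ≠ 0 := by
      rintro rfl
      simpa using hu 0 hp
    have hsup : Submodule.span ℝ F = vectorSpan ℝ F ⊔ ℝ ∙ p := by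
      apply le_antisymm
      · rw [Submodule.span_le]
        intro x hx
        have h1 : x - p ∈ vectorSpan ℝ F := vsub_mem_vectorSpan ℝ hx hp
        have h2 := Submodule.add_mem_sup h1 (Submodule.mem_span_singleton_self (R := ℝ) p)
        simpa using h2
      · refine sup_le ?_ ?_
        · rw [vectorSpan_def, Submodule.span_le]
          rintro _ ⟨a, ha, b, hb, rfl⟩
          exact sub_mem (Submodule.subset_span ha) (Submodule.subset_span hb)
        · rw [Submodule.span_singleton_le_iff_mem]
          exact Submodule.subset_span hp
    have hinf : vectorSpan ℝ F ⊓ ℝ ∙ p = ⊥ := by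
      rw [Submodule.eq_bot_iff]
      rintro x ⟨hx1, hx2⟩
      obtain ⟨c, rfl⟩ := Submodule.mem_span_singleton.1 hx2
      have := hker hx1
      simp [hu p hp] at this
      simp [this]
    have h := Submodule.finrank_sup_add_finrank_inf_eq (vectorSpan ℝ F) (ℝ ∙ p)
    rw [hinf, finrank_bot, ← hsup, finrank_span_singleton hp0] at h
    exact_mod_cast h
  · rw [Set.not_nonempty_iff_eq_empty.1 hne]
    simp

theorem vertices_convexHull_of_affineIndependent {S : Finset E}
    (hS : AffineIndependent ℝ ((↑) : S → E)) : vertices (convexHull ℝ (S : Set E)) = S := by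
  refine (extremePoints_convexHull_subset).antisymm fun s hs => ?_
  have hP : IsPolytope (convexHull ℝ (S : Set E)) := ⟨S, rfl⟩
  have hfin := hP.finite_vertices
  -- Hulls of subsets of an affinely independent set intersect in the hull of the intersection; were
  -- `s` not a vertex, the right side would be empty while the left contains `s`.
  have h : convexHull ℝ (vertices (convexHull ℝ (S : Set E))) ∩ convexHull ℝ {s} =
      convexHull ℝ (vertices (convexHull ℝ (S : Set E)) ∩ {s}) := by
    have := AffineIndependent.convexHull_inter hS (t₁ := hfin.toFinset) (t₂ := {s})
      (by rw [hfin.toFinset_subset]; exact extremePoints_convexHull_subset) (by simpa using hs)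
    simpa using this.symm
  by_contra hn
  change s ∉ vertices _ at hn
  rw [Set.inter_singleton_eq_empty.2 hn, hP.convexHull_vertices, convexHull_empty,
    convexHull_singleton, Set.inter_singleton_eq_empty] at h
  exact h (subset_convexHull ℝ _ hs)

theorem exists_pos_forall_add_nonneg {ι : Type*} (s : Finset ι) (f g : ι → ℝ)
    (h : ∀ i ∈ s, 0 < f i) : ∃ ε > 0, ∀ i ∈ s, 0 ≤ f i + ε * g i := by
  have key : ∀ i ∈ s, ∀ᶠ ε in nhdsWithin (0 : ℝ) (Set.Ioi 0), 0 ≤ f i + ε * g i := by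
    intro i hi
    apply nhdsWithin_le_nhds
    have hc : Continuous fun ε : ℝ => f i + ε * g i := by fun_prop
    have := hc.tendsto 0
    simp only [zero_mul, add_zero] at this
    exact (this.eventually (lt_mem_nhds (h i hi))).mono fun _ => le_of_lt
  have h2 := ((Filter.eventually_all_finset s).2 key).and self_mem_nhdsWithin
  obtain ⟨ε, h3, h4⟩ := h2.exists
  exact ⟨ε, h4, h3⟩

end General

/-! ### Positive spanning sets and Steinitz's theorem -/

section Steinitz

variable {E : Type*} [NormedAddCommGroup E] [NormedSpace ℝ E] [FiniteDimensional ℝ E]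

/-- By Hahn–Banach `0` is in the convex hull of the nonzero elements of `T`; Carathéodory's theorem
thins the combination out. Discarding the zero functional excludes the trivial answer `{0}`. -/
theorem exists_affineIndependent_pos_combination (T : Finset (StrongDual ℝ E)) [Nontrivial E]
    (h : ∀ w : E, w ≠ 0 → ∃ t ∈ T, t w < 0) :
    ∃ (C : Finset (StrongDual ℝ E)) (c : StrongDual ℝ E → ℝ), C ⊆ T ∧ 2 ≤ C.card ∧
      AffineIndependent ℝ ((↑) : C → StrongDual ℝ E) ∧ (∀ t ∈ C, 0 < c t) ∧
      ∑ t ∈ C, c t • t = 0 := by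
  classical
  set S : Set (StrongDual ℝ E) := {t | t ≠ 0 ∧ t ∈ T} with hS
  have hSfin : S.Finite := T.finite_toSet.subset fun t ht => ht.2
  have h0 : (0 : StrongDual ℝ E) ∈ convexHull ℝ S := by
    by_contra hn
    obtain ⟨f, a, hfa, hf⟩ := geometric_hahn_banach_point_closed (convex_convexHull ℝ S)
      (hSfin.isCompact_convexHull ℝ).isClosed hn
    rw [map_zero] at hfa
    -- In finite dimension the separating functional on the dual is evaluation at a point `w`.
    let g : Module.Dual ℝ (Module.Dual ℝ E) :=
      (f : StrongDual ℝ E →ₗ[ℝ] ℝ) ∘ₗ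
        (LinearMap.toContinuousLinearMap : (E →ₗ[ℝ] ℝ) ≃ₗ[ℝ] (E →L[ℝ] ℝ)).toLinearMap
    set w : E := (Module.evalEquiv ℝ E).symm g with hw
    have hgw : ∀ t : StrongDual ℝ E, f t = t w := by
      intro t
      have h1 : Module.evalEquiv ℝ E w = g := by simp [hw]
      have h2 := congrArg (fun k => k (t : E →ₗ[ℝ] ℝ)) h1
      have h3 : LinearMap.toContinuousLinearMap (t : E →ₗ[ℝ] ℝ) = t := by ext; rfl
      simpa [g, h3] using h2.symm
    have hnonneg : ∀ t ∈ T, 0 ≤ t w := by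
      intro t ht
      by_cases ht0 : t = 0
      · simp [ht0]
      · have := hf t (subset_convexHull ℝ _ (by simp [S, ht, ht0]))
        rw [hgw] at this
        linarith
    have hw0 : w = 0 := by
      by_contra hw0
      obtain ⟨t, ht, htw⟩ := h w hw0
      exact absurd (hnonneg t ht) (not_le.2 htw)
    obtain ⟨x, hx⟩ := exists_ne (0 : E)
    obtain ⟨t, ht, htx⟩ := h x hx
    have ht0 : t ≠ 0 := by
      rintro rfl
      simp at htx
    have := hf t (subset_convexHull ℝ _ (by simp [S, ht, ht0]))
    rw [hgw, hw0, map_zero] at this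
    linarith
  obtain ⟨ι, _, z, c, hz, hind, hpos, hsum, hcomb⟩ := eq_pos_convex_span_of_mem_convexHull h0
  have hinj := hind.injective
  refine ⟨Finset.univ.image z, fun t => ∑ i, if z i = t then c i else 0, ?_, ?_, ?_, ?_, ?_⟩
  · intro t ht
    obtain ⟨i, -, rfl⟩ := Finset.mem_image.1 ht
    have := hz ⟨i, rfl⟩
    simp [S] at this
    exact this.2
  · rw [Finset.card_image_of_injective _ hinj]
    by_contra hcard
    have hne : Nonempty ι := by
      by_contra hne
      rw [not_nonempty_iff] at hne
      simp at hsum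
    obtain ⟨i⟩ := hne
    have huniq : ∀ j, j = i := fun j =>
      Finset.card_le_one.1 (by omega : (Finset.univ : Finset ι).card ≤ 1) j (by simp) i (by simp)
    have hzi : z i ≠ 0 := by
      have := hz ⟨i, rfl⟩
      simp [S] at this
      exact this.1
    rw [Finset.sum_eq_single i (fun j _ hj => absurd (huniq j) hj) (by simp)] at hcomb
    exact (smul_ne_zero (hpos i).ne' hzi) hcomb
  · have := hind.range
    have hrange : ((Finset.univ.image z : Finset (StrongDual ℝ E)) : Set (StrongDual ℝ E)) =
        Set.range z := by simp
    rw [← hrange] at this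
    exact this
  · intro t ht
    obtain ⟨i, -, rfl⟩ := Finset.mem_image.1 ht
    simp [hinj.eq_iff, hpos i]
  · rw [Finset.sum_image (fun i _ j _ hij => hinj hij)]
    simpa [hinj.eq_iff] using hcomb

/-- Steinitz's theorem: a finite set of functionals that positively spans the dual of `W` contains
such a set with at most `2 * dim W` elements. -/
theorem exists_subset_card_le_two_mul_finrank (T : Finset (StrongDual ℝ E)) (n : ℕ) :
    ∀ W : Submodule ℝ E, Module.finrank ℝ W = n → (∀ w ∈ W, w ≠ 0 → ∃ t ∈ T, t w < 0) →
    ∃ T' ⊆ T, T'.card ≤ 2 * n ∧ ∀ w ∈ W, w ≠ 0 → ∃ t ∈ T', t w < 0 := by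
  classical
  induction n using Nat.strong_induction_on with
  | _ n ih =>
  intro W hW hT
  rcases Nat.eq_zero_or_pos n with rfl | hn
  · refine ⟨∅, by simp, by simp, fun w hw hw0 => absurd ?_ hw0⟩
    rw [Submodule.finrank_eq_zero.1 hW] at hw
    simpa using hw
  have : Nontrivial W := Module.nontrivial_of_finrank_pos (R := ℝ) (by omega)
  -- Induction step: restrict to `W` and take a minimal positive relation `C`. Where all of `C` is
  -- nonnegative it vanishes, so only the common kernel `W'` remains. With `D = span C`, `|C| ≤ dim
  -- D + 1 ≤ 2 dim D`, while `dim W' = n - dim D`.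
  let r : StrongDual ℝ E → StrongDual ℝ W := fun t => t.comp W.subtypeL
  have hr : ∀ (t : StrongDual ℝ E) (w : W), r t w = t w := fun t w => rfl
  obtain ⟨C, c, hCT, hC2, hCind, hcpos, hcsum⟩ :=
    exists_affineIndependent_pos_combination (E := W) (T.image r) (by
      intro w hw
      obtain ⟨t, ht, htw⟩ := hT w w.2 (by simpa using hw)
      exact ⟨r t, Finset.mem_image_of_mem _ ht, htw⟩)
  obtain ⟨B, hBT, hBC, hBcard⟩ : ∃ B ⊆ T, B.image r = C ∧ B.card ≤ C.card := by
    have hex : ∀ t ∈ C, ∃ s ∈ T, r s = t := fun t ht => Finset.mem_image.1 (hCT ht)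
    choose! s hs hsr using hex
    refine ⟨C.image s, ?_, ?_, Finset.card_image_le⟩
    · intro x hx
      obtain ⟨t, ht, rfl⟩ := Finset.mem_image.1 hx
      exact hs t ht
    · ext x
      simp only [Finset.mem_image]
      constructor
      · rintro ⟨_, ⟨t, ht, rfl⟩, rfl⟩
        rwa [hsr t ht]
      · intro hx
        exact ⟨s x, ⟨x, hx, rfl⟩, hsr x hx⟩
  let D : Submodule ℝ (Module.Dual ℝ W) :=
    Submodule.span ℝ ((fun t : StrongDual ℝ W => (t : W →ₗ[ℝ] ℝ)) '' C)
  have hD : C.card ≤ Module.finrank ℝ D + 1 := by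
    have h1 : Module.finrank ℝ (vectorSpan ℝ (Set.range ((↑) : C → StrongDual ℝ W))) + 1 = C.card := by
      have : Nonempty C := by
        rw [← Fintype.card_pos_iff, Fintype.card_coe]
        omega
      have := hCind.finrank_vectorSpan_add_one
      simpa using this
    have h2 : Module.finrank ℝ (vectorSpan ℝ (Set.range ((↑) : C → StrongDual ℝ W))) ≤
        Module.finrank ℝ (Submodule.span ℝ (C : Set (StrongDual ℝ W))) := by
      apply Submodule.finrank_mono
      rw [vectorSpan_def, Submodule.span_le]
      rintro _ ⟨a, ⟨a', rfl⟩, b, ⟨b', rfl⟩, rfl⟩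
      exact sub_mem (Submodule.subset_span a'.2) (Submodule.subset_span b'.2)
    let e : StrongDual ℝ W ≃ₗ[ℝ] Module.Dual ℝ W :=
      (LinearMap.toContinuousLinearMap : (W →ₗ[ℝ] ℝ) ≃ₗ[ℝ] (W →L[ℝ] ℝ)).symm
    have h3 : D = (Submodule.span ℝ (C : Set (StrongDual ℝ W))).map (e : _ →ₗ[ℝ] _) := by
      rw [Submodule.map_span]
      rfl
    rw [h3, LinearEquiv.finrank_map_eq]
    omega
  have hDc := Subspace.finrank_add_finrank_dualCoannihilator_eq D
  set W' : Submodule ℝ E := D.dualCoannihilator.map W.subtype with hW'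
  have hfin : Module.finrank ℝ W' = Module.finrank ℝ D.dualCoannihilator :=
    Submodule.finrank_map_subtype_eq W _
  have hW'W : W' ≤ W := Submodule.map_subtype_le _ _
  obtain ⟨T', hT', hcard, hneg⟩ := ih (Module.finrank ℝ W') (by omega) W' rfl
    (fun w hw => hT w (hW'W hw))
  refine ⟨B ∪ T', Finset.union_subset hBT hT', ?_, ?_⟩
  · refine (Finset.card_union_le _ _).trans ?_
    omega
  · intro w hw hw0
    by_cases hwW : w ∈ W'
    · obtain ⟨t, ht, h⟩ := hneg w hwW hw0
      exact ⟨t, Finset.mem_union_right _ ht, h⟩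
    · by_contra hcon
      push Not at hcon
      have hnn : ∀ t ∈ C, 0 ≤ t ⟨w, hw⟩ := by
        intro t ht
        rw [← hBC] at ht
        obtain ⟨s, hs, rfl⟩ := Finset.mem_image.1 ht
        exact hcon s (Finset.mem_union_left _ hs)
      have hs : ∑ t ∈ C, c t * t ⟨w, hw⟩ = 0 := by
        have := congrArg (fun f : StrongDual ℝ W => f ⟨w, hw⟩) hcsum
        simpa [sum_apply] using this
      have hz := (Finset.sum_eq_zero_iff_of_nonneg
        (fun t ht => mul_nonneg (hcpos t ht).le (hnn t ht))).1 hs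
      refine hwW (Submodule.mem_map.2 ⟨⟨w, hw⟩, ?_, rfl⟩)
      rw [Submodule.mem_dualCoannihilator]
      intro φ hφ
      induction hφ using Submodule.span_induction with
      | mem φ h =>
        obtain ⟨t, ht, rfl⟩ := h
        exact (mul_eq_zero.1 (hz t ht)).resolve_left (hcpos t ht).ne'
      | zero => rfl
      | add a b _ _ ha hb => rw [LinearMap.add_apply, ha, hb, add_zero]
      | smul k a _ ha => rw [LinearMap.smul_apply, ha, smul_zero]

end Steinitz

/-! ### Facets of `P` as vertices of the dual polytope -/

section DualFaces

variable {E : Type*} [NormedAddCommGroup E] [NormedSpace ℝ E]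

/-- The face of `P` cut out by an element `u` of the dual polytope. -/
def dualFace (P : Set E) (u : StrongDual ℝ E) : Set E :=
  {x ∈ P | u x = -1}

theorem isExposed_dualFace {P : Set E} {u : StrongDual ℝ E} (hu : u ∈ dualPolytope P) :
    IsExposed ℝ P (dualFace P u) :=
  isExposed_sep u (-1) hu

theorem vertices_dualFace {P : Set E} {u : StrongDual ℝ E} (hu : u ∈ dualPolytope P) :
    vertices (dualFace P u) = {v ∈ vertices P | u v = -1} := by
  rw [vertices_of_isExposed (isExposed_dualFace hu)]
  ext x
  constructor
  · rintro ⟨⟨-, h⟩, hx⟩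
    exact ⟨hx, h⟩
  · rintro ⟨hx, h⟩
    exact ⟨⟨extremePoints_subset hx, h⟩, hx⟩

theorem mem_dualPolytope_iff {P : Set E} (hP : IsPolytope P) {y : StrongDual ℝ E} :
    y ∈ dualPolytope P ↔ ∀ v ∈ vertices P, -1 ≤ y v := by
  constructor
  · exact fun h v hv => h v (extremePoints_subset hv)
  · intro h x hx
    rw [← hP.convexHull_vertices] at hx
    exact convexHull_min (t := {x | -1 ≤ y x}) h (convex_halfSpace_ge y.toLinearMap.isLinear _) hx

theorem vertices_subset_dualPolytope {P : Set E} :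
    vertices (dualPolytope P) ⊆ dualPolytope P :=
  extremePoints_subset

theorem exists_vertex_dual_nonpos {P : Set E} (hD : IsPolytope (dualPolytope P)) (x : E) :
    ∃ u ∈ vertices (dualPolytope P), u x ≤ 0 := by
  by_contra! h
  have h0 : (0 : StrongDual ℝ E) ∈ dualPolytope P := fun y _ => by simp
  rw [← hD.convexHull_vertices] at h0
  have hl : IsLinearMap ℝ fun u : StrongDual ℝ E => u x := ⟨fun _ _ => rfl, fun _ _ => rfl⟩
  have := convexHull_min (t := {u : StrongDual ℝ E | 0 < u x}) h (convex_halfSpace_gt hl 0) h0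
  simp at this

/-- Bipolar theorem: a functional separating `x` from `P`, rescaled, belongs to the dual polytope,
and so is an average of its vertices. -/
theorem mem_iff_forall_vertex_dual {P : Set E} (hP : IsPolytope P) (h0 : (0 : E) ∈ P)
    (hD : IsPolytope (dualPolytope P)) {x : E} :
    x ∈ P ↔ ∀ u ∈ vertices (dualPolytope P), -1 ≤ u x := by
  refine ⟨fun hx u hu => vertices_subset_dualPolytope hu x hx, fun h => ?_⟩
  by_contra hx
  obtain ⟨f, a, hfa, hf⟩ := geometric_hahn_banach_point_closed hP.convex hP.isCompact.isClosed hx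
  have ha : a < 0 := by simpa using hf 0 h0
  have hy : (-a)⁻¹ • f ∈ dualPolytope P := by
    intro b hb
    have := hf b hb
    rw [smul_apply, smul_eq_mul, inv_mul_eq_div, le_div_iff₀ (by linarith)]
    linarith
  rw [← hD.convexHull_vertices] at hy
  have hl : IsLinearMap ℝ fun u : StrongDual ℝ E => u x := ⟨fun _ _ => rfl, fun _ _ => rfl⟩
  have := convexHull_min (t := {u : StrongDual ℝ E | -1 ≤ u x}) h (convex_halfSpace_ge hl _) hy
  simp only [Set.mem_ofPred_eq, smul_apply, smul_eq_mul] at this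
  rw [inv_mul_eq_div, le_div_iff₀ (by linarith)] at this
  linarith

/-- Otherwise the whole ray through `x` would lie in the bounded set `P`. -/
theorem eq_zero_of_forall_vertex_dual_nonneg {P : Set E} (hP : IsPolytope P) (h0 : (0 : E) ∈ P)
    (hD : IsPolytope (dualPolytope P)) {x : E}
    (h : ∀ u ∈ vertices (dualPolytope P), 0 ≤ u x) : x = 0 := by
  obtain ⟨C, hC⟩ := hP.isCompact.isBounded.exists_norm_le
  by_contra hx
  have hmem : ((|C| + 1) / ‖x‖) • x ∈ P := by
    rw [mem_iff_forall_vertex_dual hP h0 hD]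
    intro u hu
    have h1 := h u hu
    rw [map_smul, smul_eq_mul]
    have : 0 ≤ (|C| + 1) / ‖x‖ * u x := by positivity
    linarith
  have h2 := hC _ hmem
  rw [norm_smul, Real.norm_of_nonneg (by positivity),
    div_mul_cancel₀ _ (norm_ne_zero_iff.2 hx)] at h2
  linarith [le_abs_self C]

theorem span_dualFace {P : Set E} (hP : IsPolytope P) {u : StrongDual ℝ E}
    (hu : u ∈ dualPolytope P) :
    Submodule.span ℝ (dualFace P u) = Submodule.span ℝ {v ∈ vertices P | u v = -1} := by
  rw [← vertices_dualFace hu, (hP.of_isExposed (isExposed_dualFace hu)).span_vertices]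

theorem polyDim_eq_finrank {P : Set E} (h0 : (0 : E) ∈ interior P) :
    polyDim P = Module.finrank ℝ E := by
  have hne : P.Nonempty := ⟨0, interior_subset h0⟩
  have h1 : affineSpan ℝ P = ⊤ := by
    refine top_unique ?_
    rw [← isOpen_interior.affineSpan_eq_top ⟨0, h0⟩]
    exact affineSpan_mono ℝ interior_subset
  rw [polyDim, if_pos hne, AffineSubspace.vectorSpan_eq_top_of_affineSpan_eq_top ℝ E E h1,
    finrank_top]

/-- The hypotheses put `q` in the cone over the facet of `u`, on the hyperplane `u' = u`. Unless `q
= 0`, rescaling moves it into the common face, which is cut out by the midpoint of `u` and `u'` and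
spanned by its vertices. -/
theorem mem_span_common_vertices {P : Set E} (hP : IsPolytope P) (h0 : (0 : E) ∈ P)
    (hD : IsPolytope (dualPolytope P)) {u u' : StrongDual ℝ E}
    (hu : u ∈ vertices (dualPolytope P)) (hu' : u' ∈ vertices (dualPolytope P)) {q : E}
    (hq : ∀ t ∈ vertices (dualPolytope P), u q ≤ t q) (hqu : u' q = u q) :
    q ∈ Submodule.span ℝ {v ∈ vertices P | u v = -1 ∧ u' v = -1} := by
  rcases le_or_gt 0 (u q) with h | h
  · rw [eq_zero_of_forall_vertex_dual_nonneg hP h0 hD fun t ht => h.trans (hq t ht)]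
    exact zero_mem _
  set y : StrongDual ℝ E := (2 : ℝ)⁻¹ • (u + u') with hy
  have hu1 := vertices_subset_dualPolytope hu
  have hu1' := vertices_subset_dualPolytope hu'
  have hyx : ∀ x, y x = (u x + u' x) / 2 := fun x => by simp [hy]; ring
  have hyD : y ∈ dualPolytope P := by
    intro x hx
    rw [hyx]
    linarith [hu1 x hx, hu1' x hx]
  have hface : {v ∈ vertices P | y v = -1} ⊆ {v ∈ vertices P | u v = -1 ∧ u' v = -1} := by
    rintro v ⟨hv, hyv⟩
    rw [hyx] at hyv
    have h1 := hu1 v (extremePoints_subset hv)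
    have h2 := hu1' v (extremePoints_subset hv)
    exact ⟨hv, by linarith, by linarith⟩
  have hmem : (-(u q))⁻¹ • q ∈ dualFace P y := by
    refine ⟨?_, ?_⟩
    · rw [mem_iff_forall_vertex_dual hP h0 hD]
      intro t ht
      rw [map_smul, smul_eq_mul, inv_mul_eq_div, le_div_iff₀ (by linarith)]
      linarith [hq t ht]
    · rw [map_smul, smul_eq_mul, hyx, hqu]
      have := h.ne
      field_simp
      ring
  have h2 := Submodule.span_mono (R := ℝ) hface
    (span_dualFace hP hyD ▸ Submodule.subset_span hmem)
  have h3 := Submodule.smul_mem _ (-(u q)) h2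
  rwa [smul_inv_smul₀ (by linarith)] at h3

variable [FiniteDimensional ℝ E]

/-- A nonzero functional vanishing on these vertices could be added to and subtracted from `u` in
small multiples without leaving the dual polytope, against extremality. -/
theorem span_eq_top_of_vertex_dual {P : Set E} (hP : IsPolytope P) {u : StrongDual ℝ E}
    (hu : u ∈ vertices (dualPolytope P)) :
    Submodule.span ℝ {v ∈ vertices P | u v = -1} = ⊤ := by
  by_contra hne
  obtain ⟨f, hf0, hf⟩ := Submodule.exists_le_ker_of_lt_top _ (lt_top_iff_ne_top.2 hne)
  set y : StrongDual ℝ E := LinearMap.toContinuousLinearMap f with hy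
  have hyf : ∀ x, y x = f x := fun x => rfl
  have hvan : ∀ v ∈ vertices P, u v = -1 → y v = 0 := fun v hv huv =>
    hf (Submodule.subset_span ⟨hv, huv⟩)
  have hu1 := vertices_subset_dualPolytope hu
  rw [mem_dualPolytope_iff hP] at hu1
  have key : ∀ z : StrongDual ℝ E, (∀ v ∈ vertices P, u v = -1 → z v = 0) →
      ∃ ε > 0, ∀ v ∈ vertices P, -1 ≤ u v + ε * z v := by
    intro z hz
    classical
    obtain ⟨ε, hε, h⟩ := exists_pos_forall_add_nonneg
      (hP.finite_vertices.toFinset.filter fun v => u v ≠ -1) (fun v => u v + 1) z (by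
        intro v hv
        simp only [Finset.mem_filter, Set.Finite.mem_toFinset] at hv
        have := lt_of_le_of_ne (hu1 v hv.1) (Ne.symm hv.2)
        linarith)
    refine ⟨ε, hε, fun v hv => ?_⟩
    by_cases huv : u v = -1
    · rw [hz v hv huv, huv]
      simp
    · have := h v (by simp [hv, huv])
      linarith
  obtain ⟨ε₁, hε₁, h₁⟩ := key y hvan
  obtain ⟨ε₂, hε₂, h₂⟩ := key (-y) (fun v hv huv => by simp [hvan v hv huv])
  have hm₁ : u + ε₁ • y ∈ dualPolytope P := (mem_dualPolytope_iff hP).2 fun v hv => by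
    simpa using h₁ v hv
  have hm₂ : u + ε₂ • (-y) ∈ dualPolytope P := (mem_dualPolytope_iff hP).2 fun v hv => by
    simpa using h₂ v hv
  have hseg : u ∈ openSegment ℝ (u + ε₁ • y) (u + ε₂ • (-y)) := by
    refine ⟨ε₂ / (ε₁ + ε₂), ε₁ / (ε₁ + ε₂), by positivity, by positivity, by field_simp; ring, ?_⟩
    ext x
    simp only [add_apply, smul_apply, neg_apply, smul_eq_mul]
    field_simp
    ring
  have heq := (mem_extremePoints.1 hu).2 _ hm₁ _ hm₂ hseg
  have hy0 : ε₁ • y = 0 := by simpa using heq.1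
  have : y = 0 := (smul_eq_zero.1 hy0).resolve_left hε₁.ne'
  exact hf0 (by ext x; rw [← hyf, this]; rfl)

theorem facets_eq_image {P : Set E} (hP : IsPolytope P) (h0 : (0 : E) ∈ interior P)
    [Nontrivial E] :
    facets P = dualFace P '' vertices (dualPolytope P) := by
  have hdim := polyDim_eq_finrank h0
  have hpos : 0 < Module.finrank ℝ E := Module.finrank_pos
  ext F
  constructor
  · rintro ⟨hF, hFdim⟩
    have hne : F.Nonempty := by
      by_contra hne
      rw [polyDim, if_neg hne] at hFdim
      omega
    obtain ⟨p, hp⟩ := hne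
    obtain ⟨l, hl⟩ := hF ⟨p, hp⟩
    have hp' : p ∈ P ∧ ∀ y ∈ P, l y ≤ l p := by rwa [hl] at hp
    -- With `0` interior, a nonpositive maximum makes `l` zero, so the face would be all of `P`, of
    -- the wrong dimension.
    have hlp : 0 < l p := by
      by_contra hle
      have hker : l = 0 := by
        have hmax : IsLocalMax l 0 := by
          filter_upwards [mem_interior_iff_mem_nhds.1 h0] with y hy
          rw [map_zero]
          exact (hp'.2 y hy).trans (not_lt.1 hle)
        have := hmax.fderiv_eq_zero
        rwa [ContinuousLinearMap.fderiv] at this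
      have hFP : F = P := by
        rw [hl, hker]
        ext x
        simp
      rw [hFP] at hFdim
      omega
    set u : StrongDual ℝ E := -(l p)⁻¹ • l with hu
    have hux : ∀ x, u x = -(l x / l p) := fun x => by
      simp [hu, div_eq_inv_mul]
    have huD : u ∈ dualPolytope P := by
      intro x hx
      rw [hux, neg_le_neg_iff, div_le_one hlp]
      exact hp'.2 x hx
    have hFu : F = dualFace P u := by
      rw [hl]
      ext x
      simp only [dualFace, Set.mem_ofPred_eq, hux, neg_inj, div_eq_one_iff_eq hlp.ne']
      constructor
      · rintro ⟨hx, hm⟩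
        exact ⟨hx, le_antisymm (hp'.2 x hx) (hm p hp'.1)⟩
      · rintro ⟨hx, hm⟩
        exact ⟨hx, fun y hy => hm ▸ hp'.2 y hy⟩
    refine ⟨u, ?_, hFu.symm⟩
    have hspan : Submodule.span ℝ F = ⊤ := by
      apply Submodule.eq_top_of_finrank_eq
      have := finrank_span_eq_polyDim_add_one (F := F) u (fun x hx => by
        rw [hFu] at hx
        exact hx.2)
      omega
    -- Both ends of the segment are at least `-1` on `F` and average to `-1`; as `F` spans the
    -- space, they equal `u`.
    refine mem_extremePoints_iff_left.2 ⟨huD, fun y hy z hz hseg => ?_⟩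
    obtain ⟨a, b, ha, hb, hab, hyz⟩ := hseg
    have hyF : ∀ x ∈ F, y x = u x := by
      intro x hx
      rw [hFu] at hx
      have h1 := hy x hx.1
      have h2 := hz x hx.1
      have h3 : a * y x + b * z x = -1 := by
        rw [← hx.2, ← hyz]
        simp
      rw [hx.2]
      nlinarith
    ext x
    have hx : x ∈ Submodule.span ℝ F := hspan ▸ Submodule.mem_top
    exact LinearMap.eqOn_span (f := y.toLinearMap) (g := u.toLinearMap) hyF hx
  · rintro ⟨u, hu, rfl⟩
    have huD := vertices_subset_dualPolytope hu
    refine ⟨isExposed_dualFace huD, ?_⟩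
    rw [← finrank_span_eq_polyDim_add_one u fun x hx => hx.2, span_dualFace hP huD,
      span_eq_top_of_vertex_dual hP hu, finrank_top, hdim]

end DualFaces

/-! ### Adjacent facets and ridges -/

section Adjacency

variable {E : Type*} [NormedAddCommGroup E] [NormedSpace ℝ E] [FiniteDimensional ℝ E]

/-- The vertices of the dual polytope whose facets of `P` meet the facet of `u` in codimension two;
the condition says that the common vertices span the hyperplane where both functionals agree. -/
def adjacent (P : Set E) (u : StrongDual ℝ E) : Set (StrongDual ℝ E) :=
  {u' ∈ vertices (dualPolytope P) | u' ≠ u ∧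
    Submodule.span ℝ {v ∈ vertices P | u v = -1 ∧ u' v = -1} =
      LinearMap.ker ((u' - u : StrongDual ℝ E) : E →ₗ[ℝ] ℝ)}

theorem finrank_ker_add_one {f : StrongDual ℝ E} (hf : f ≠ 0) :
    Module.finrank ℝ (LinearMap.ker (f : E →ₗ[ℝ] ℝ)) + 1 = Module.finrank ℝ E := by
  have hf' : (f : E →ₗ[ℝ] ℝ) ≠ 0 := fun h => hf (by ext x; exact LinearMap.congr_fun h x)
  have h1 := LinearMap.finrank_range_add_finrank_ker (f : E →ₗ[ℝ] ℝ)
  rw [LinearMap.range_eq_top.2 (LinearMap.surjective hf'), finrank_top, Module.finrank_self] at h1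
  omega

/-- The sum of the vertices of the facet of `u` lies strictly on one side of every other facet. -/
theorem exists_forall_vertex_dual_lt {P : Set E} (hP : IsPolytope P) {u : StrongDual ℝ E}
    (hu : u ∈ vertices (dualPolytope P)) :
    ∃ x₀ : E, ∀ u' ∈ vertices (dualPolytope P), u' ≠ u → u x₀ < u' x₀ := by
  have hfin : {v ∈ vertices P | u v = -1}.Finite := hP.finite_vertices.subset fun v hv => hv.1
  refine ⟨∑ v ∈ hfin.toFinset, v, fun u' hu' hne => ?_⟩
  rw [map_sum, map_sum]
  have hle : ∀ v ∈ hfin.toFinset, u v ≤ u' v := by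
    intro v hv
    rw [hfin.mem_toFinset] at hv
    rw [hv.2]
    exact vertices_subset_dualPolytope hu' v (extremePoints_subset hv.1)
  refine Finset.sum_lt_sum hle ?_
  by_contra! hcon
  refine hne ?_
  ext x
  have hx : x ∈ Submodule.span ℝ {v ∈ vertices P | u v = -1} :=
    span_eq_top_of_vertex_dual hP hu ▸ Submodule.mem_top
  refine LinearMap.eqOn_span (f := u'.toLinearMap) (g := u.toLinearMap) (fun v hv => ?_) hx
  have hv' := hfin.mem_toFinset.2 hv
  exact le_antisymm (hcon v hv') (hle v hv')

/-- An irredundant system `T'` of inequalities `u ≤ t` for the cone over the facet of `u` consists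
of adjacent facets. It must contain one negative at `w`, since otherwise every dual vertex would be
nonnegative at `w`. -/
theorem exists_adjacent_neg {P : Set E} (hP : IsPolytope P) (h0 : (0 : E) ∈ P)
    (hD : IsPolytope (dualPolytope P)) {u : StrongDual ℝ E}
    (hu : u ∈ vertices (dualPolytope P)) {w : E} (huw : u w = 0) (hw : w ≠ 0) :
    ∃ u' ∈ adjacent P u, u' w < 0 := by
  classical
  set T : Finset (StrongDual ℝ E) := hD.finite_vertices.toFinset with hT
  have hmemT : ∀ {t}, t ∈ T ↔ t ∈ vertices (dualPolytope P) := by simp [hT]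
  obtain ⟨T', hT'mem, hmin⟩ := Finset.exists_min_image
    (T.powerset.filter fun S => u ∉ S ∧ ∀ x, (∀ t ∈ S, u x ≤ t x) → ∀ t ∈ T, u x ≤ t x)
    Finset.card ⟨T.erase u, by
      simp only [Finset.mem_filter, Finset.mem_powerset]
      refine ⟨Finset.erase_subset _ _, by simp, fun x hx t ht => ?_⟩
      by_cases htu : t = u
      · rw [htu]
      · exact hx t (Finset.mem_erase.2 ⟨htu, ht⟩)⟩
  simp only [Finset.mem_filter, Finset.mem_powerset] at hT'mem hmin
  obtain ⟨hT'T, huT', hcone⟩ := hT'mem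
  obtain ⟨u', hu'T', hneg⟩ : ∃ u' ∈ T', u' w < 0 := by
    by_contra! hcon
    refine hw (eq_zero_of_forall_vertex_dual_nonneg hP h0 hD fun t ht => ?_)
    rw [← huw]
    exact hcone w (fun t ht => huw ▸ hcon t ht) t (hmemT.2 ht)
  have hu' := hmemT.1 (hT'T hu'T')
  have hne : u' ≠ u := fun h => huT' (h ▸ hu'T')
  -- By minimality of `T'`, dropping `u'` enlarges the cone.
  obtain ⟨x, hx1, hx2⟩ : ∃ x, (∀ t ∈ T'.erase u', u x ≤ t x) ∧ u' x < u x := by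
    by_contra! hcon
    have := hmin (T'.erase u') ⟨(Finset.erase_subset _ _).trans hT'T,
      fun h => huT' (Finset.mem_of_mem_erase h), fun x hx => hcone x fun t ht => by
        by_cases htu : t = u'
        · exact htu ▸ hcon x hx
        · exact hx t (Finset.mem_erase.2 ⟨htu, ht⟩)⟩
    have h2 := Finset.card_erase_lt_of_mem hu'T'
    omega
  -- On the segment from `x` to the cone's interior point `x₀`, up to scaling, `z` is where `u' =
  -- u`; the other inequalities are strict there. Small moves of `z` within the hyperplane stay in
  -- the cone, so the common vertices span it.
  obtain ⟨x₀, hx₀⟩ := exists_forall_vertex_dual_lt hP hu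
  set a := u' x₀ - u x₀ with ha
  set b := u x - u' x with hb
  have hapos : 0 < a := by linarith [hx₀ u' hu' hne]
  have hbpos : 0 < b := by linarith
  set z := a • x + b • x₀ with hz
  have hzval : ∀ t : StrongDual ℝ E, t z - u z = a * (t x - u x) + b * (t x₀ - u x₀) := by
    intro t
    simp only [hz, map_add, map_smul, smul_eq_mul]
    ring
  have hzu' : u' z = u z := by
    have := hzval u'
    rw [← ha] at this
    have h2 : u' x - u x = -b := by rw [hb]; ring
    rw [h2] at this
    linarith
  have hzpos : ∀ t ∈ T'.erase u', 0 < t z - u z := by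
    intro t ht
    rw [hzval]
    have h1 := hx1 t ht
    have htT' := Finset.mem_of_mem_erase ht
    have h2 := hx₀ t (hmemT.1 (hT'T htT')) (fun h => huT' (h ▸ htT'))
    have h3 : 0 ≤ a * (t x - u x) := mul_nonneg hapos.le (by linarith)
    have h4 : 0 < b * (t x₀ - u x₀) := mul_pos hbpos (by linarith)
    linarith
  have hzy : ∀ y : E, u' y = u y → ∃ ε : ℝ, 0 < ε ∧ z + ε • y ∈
      Submodule.span ℝ {v ∈ vertices P | u v = -1 ∧ u' v = -1} := by
    intro y hy
    obtain ⟨ε, hε, hge⟩ := exists_pos_forall_add_nonneg (T'.erase u') (fun t => t z - u z)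
      (fun t => t y - u y) hzpos
    refine ⟨ε, hε, mem_span_common_vertices hP h0 hD hu hu' ?_ (by simp [hzu', hy])⟩
    intro t ht
    refine hcone _ (fun s hs => ?_) t (hmemT.2 ht)
    simp only [map_add, map_smul, smul_eq_mul]
    by_cases hsu : s = u'
    · rw [hsu, hzu', hy]
    · have := hge s (Finset.mem_erase.2 ⟨hsu, hs⟩)
      linarith
  refine ⟨u', ⟨hu', hne, le_antisymm (Submodule.span_le.2 ?_) ?_⟩, hneg⟩
  · rintro v ⟨-, h1, h2⟩
    simp [h1, h2]
  · intro y hy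
    have hy' : u' y = u y := by simpa [sub_eq_zero] using hy
    obtain ⟨ε, hε, h1⟩ := hzy y hy'
    obtain ⟨_, -, h2⟩ := hzy 0 (by simp)
    rw [smul_zero, add_zero] at h2
    have h3 := sub_mem h1 h2
    rw [add_sub_cancel_left] at h3
    exact (Submodule.smul_mem_iff _ hε.ne').1 h3

/-- Intersecting with the facet of `u` gives a ridge. If `u₁` and `u₂` gave the same ridge, `u₁ - u`
and `u₂ - u` would be positive multiples of each other, and extremality forces equality. -/
theorem ncard_adjacent_le_ncard_facets {P : Set E} (hP : IsPolytope P) {u : StrongDual ℝ E}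
    (hu : u ∈ vertices (dualPolytope P)) :
    (adjacent P u).ncard ≤ (facets (dualFace P u)).ncard := by
  have huD := vertices_subset_dualPolytope hu
  have hF := hP.of_isExposed (isExposed_dualFace huD)
  have hsubD : ∀ t ∈ vertices (dualPolytope P), t ∈ dualPolytope (dualFace P u) :=
    fun t ht x hx => vertices_subset_dualPolytope ht x hx.1
  have hspan : ∀ u' ∈ adjacent P u, Submodule.span ℝ (dualFace (dualFace P u) u') =
      LinearMap.ker ((u' - u : StrongDual ℝ E) : E →ₗ[ℝ] ℝ) := by
    intro u' hu'
    rw [span_dualFace hF (hsubD u' hu'.1), vertices_dualFace huD, ← hu'.2.2]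
    congr 1
    ext v
    exact and_assoc
  refine Set.ncard_le_ncard_of_injOn (dualFace (dualFace P u)) ?_ ?_ hF.finite_facets
  · intro u' hu'
    refine ⟨isExposed_dualFace (hsubD u' hu'.1), ?_⟩
    have h1 := finrank_span_eq_polyDim_add_one (F := dualFace P u) u fun x hx => hx.2
    have h2 := finrank_span_eq_polyDim_add_one (F := dualFace (dualFace P u) u') u
      fun x hx => hx.1.2
    rw [hspan u' hu'] at h2
    rw [span_dualFace hP huD, span_eq_top_of_vertex_dual hP hu, finrank_top] at h1
    have h3 := finrank_ker_add_one (sub_ne_zero.2 hu'.2.1)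
    omega
  · intro u₁ h₁ u₂ h₂ heq
    obtain ⟨x₀, hx₀⟩ := exists_forall_vertex_dual_lt hP hu
    have hker := (hspan u₁ h₁).symm.trans ((congrArg _ heq).trans (hspan u₂ h₂))
    have hp₁ : 0 < u₁ x₀ - u x₀ := sub_pos.2 (hx₀ u₁ h₁.1 h₁.2.1)
    have hp₂ : 0 < u₂ x₀ - u x₀ := sub_pos.2 (hx₀ u₂ h₂.1 h₂.2.1)
    have hprop : ∀ x, (u₁ x₀ - u x₀) * (u₂ x - u x) = (u₂ x₀ - u x₀) * (u₁ x - u x) := by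
      intro x
      have hm : (u₁ x₀ - u x₀) • x - (u₁ x - u x) • x₀ ∈
          LinearMap.ker ((u₁ - u : StrongDual ℝ E) : E →ₗ[ℝ] ℝ) := by
        rw [LinearMap.mem_ker]
        simp
        ring
      rw [hker, LinearMap.mem_ker] at hm
      simp at hm
      linarith
    have haux : ∀ {s t : StrongDual ℝ E}, s ∈ adjacent P u → t ∈ adjacent P u →
        0 < s x₀ - u x₀ → s x₀ - u x₀ < t x₀ - u x₀ →
        (∀ x, (t x₀ - u x₀) * (s x - u x) = (s x₀ - u x₀) * (t x - u x)) → False := by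
      intro s t hs ht hpos hlt hst
      have hpt := hpos.trans hlt
      refine hs.2.1 ((mem_extremePoints.1 hs.1).2 u huD t
        (vertices_subset_dualPolytope ht.1) ?_).1.symm
      refine ⟨1 - (s x₀ - u x₀) / (t x₀ - u x₀), (s x₀ - u x₀) / (t x₀ - u x₀),
        by rw [sub_pos, div_lt_one hpt]; exact hlt, by positivity, by ring, ?_⟩
      ext x
      have := hst x
      simp only [add_apply, smul_apply, smul_eq_mul]
      have hne := hpt.ne'
      generalize t x₀ - u x₀ = p at *
      generalize s x₀ - u x₀ = r at *
      field_simp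
      linarith
    rcases lt_trichotomy (u₁ x₀ - u x₀) (u₂ x₀ - u x₀) with h | h | h
    · exact (haux h₁ h₂ hp₁ h fun x => (hprop x).symm).elim
    · ext x
      have := hprop x
      rw [h] at this
      have := mul_left_cancel₀ hp₂.ne' this
      linarith
    · exact (haux h₂ h₁ hp₂ h hprop).elim

end Adjacency

/-! ### Counting vertices by level -/

section Counting

variable {E : Type*} [NormedAddCommGroup E] [NormedSpace ℝ E]

theorem ncard_vertices_le_of_sum_nonpos {P : Set E} (hP : IsPolytope P) {u : StrongDual ℝ E}
    (huD : u ∈ dualPolytope P) (hint : ∀ v ∈ vertices P, ∃ k : ℤ, u v = k)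
    (hsum : u (∑ v ∈ hP.finite_vertices.toFinset, v) ≤ 0) :
    (vertices P).ncard ≤
      2 * {v ∈ vertices P | u v = -1}.ncard + {v ∈ vertices P | u v = 0}.ncard := by
  classical
  set V := hP.finite_vertices.toFinset with hV
  have hmem : ∀ {v}, v ∈ V ↔ v ∈ vertices P := by simp [hV]
  have hcoe : ∀ c : ℝ, {v ∈ vertices P | u v = c} = (V.filter fun v => u v = c : Finset E) := by
    intro c
    ext v
    simp [hmem]
  rw [hcoe, hcoe, Set.ncard_coe_finset, Set.ncard_coe_finset,
    Set.ncard_eq_toFinset_card _ hP.finite_vertices, ← hV]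
  rw [map_sum] at hsum
  -- Equality on levels `-1`, `0`, `1`; summed over all vertices, the `u v` term is nonpositive.
  have hle : ∀ v ∈ V, (1 : ℝ) ≤ u v + (2 * (if u v = -1 then 1 else 0) +
      (if u v = 0 then 1 else 0)) := by
    intro v hv
    have h1 := huD v (extremePoints_subset (hmem.1 hv))
    obtain ⟨k, hk⟩ := hint v (hmem.1 hv)
    rw [hk] at h1 ⊢
    have hk1 : -1 ≤ k := by exact_mod_cast h1
    rcases (by omega : k = -1 ∨ k = 0 ∨ 1 ≤ k) with rfl | rfl | h
    · norm_num
    · norm_num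
    · have : (1 : ℝ) ≤ k := by exact_mod_cast h
      split_ifs <;> linarith
  have h := Finset.sum_le_sum hle
  rw [Finset.sum_add_distrib, Finset.sum_add_distrib, ← Finset.mul_sum, Finset.sum_boole,
    Finset.sum_boole, Finset.sum_const, nsmul_eq_mul, mul_one] at h
  have h2 : (V.card : ℝ) ≤ 2 * (V.filter fun v => u v = -1).card +
      (V.filter fun v => u v = 0).card := by linarith
  exact_mod_cast h2

theorem ncard_vertices_facet_le {P : Set E} (hP : IsPolytope P) {F : Set E} (hF : F ∈ facets P) :
    (vertices F).ncard ≤ maxFacetVertices P := by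
  refine le_csSup ?_ ⟨F, hF, rfl⟩
  refine ((hP.finite_facets.image fun F => (vertices F).ncard).subset ?_).bddAbove
  rintro _ ⟨F, hF, rfl⟩
  exact ⟨F, hF, rfl⟩

theorem ncard_facets_facet_le {P : Set E} (hP : IsPolytope P) {F : Set E} (hF : F ∈ facets P) :
    (facets F).ncard ≤ maxFacetFacets P := by
  refine le_csSup ?_ ⟨F, hF, rfl⟩
  refine ((hP.finite_facets.image fun F => (facets F).ncard).subset ?_).bddAbove
  rintro _ ⟨F, hF, rfl⟩
  exact ⟨F, hF, rfl⟩

theorem maxFacetVertices_eq {P : Set E} (hP : IsPolytope P) {n : ℕ} (hne : (facets P).Nonempty)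
    (h : ∀ F ∈ facets P, (vertices F).ncard = n) : maxFacetVertices P = n := by
  obtain ⟨F, hF⟩ := hne
  refine le_antisymm (csSup_le ⟨_, F, hF, rfl⟩ ?_) (h F hF ▸ ncard_vertices_facet_le hP hF)
  rintro _ ⟨G, hG, rfl⟩
  exact (h G hG).le

theorem maxFacetFacets_eq {P : Set E} (hP : IsPolytope P) {n : ℕ} (hne : (facets P).Nonempty)
    (h : ∀ F ∈ facets P, (facets F).ncard = n) : maxFacetFacets P = n := by
  obtain ⟨F, hF⟩ := hne
  refine le_antisymm (csSup_le ⟨_, F, hF, rfl⟩ ?_) (h F hF ▸ ncard_facets_facet_le hP hF)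
  rintro _ ⟨G, hG, rfl⟩
  exact (h G hG).le

theorem finrank_span_le_ncard {s : Set E} (hs : s.Finite) :
    Module.finrank ℝ (Submodule.span ℝ s) ≤ s.ncard := by
  rw [Set.ncard_eq_toFinset_card s hs]
  have := finrank_span_finset_le_card (R := ℝ) hs.toFinset
  rwa [hs.coe_toFinset] at this

variable [FiniteDimensional ℝ E]

/-- The vertices on level zero with respect to a facet lie in the adjacent facets. -/
theorem ncard_level_zero_le {P : Set E} (hP : IsPolytope P) {u : StrongDual ℝ E}
    (hint : ∀ t ∈ vertices (dualPolytope P), ∀ v ∈ vertices P, ∃ k : ℤ, t v = k)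
    (hv0 : ∀ v ∈ vertices P, v ≠ 0) {α : ℕ}
    (hα : ∀ t ∈ vertices (dualPolytope P), {v ∈ vertices P | t v = -1}.ncard ≤ α)
    (B : Finset (StrongDual ℝ E)) (hB : ∀ t ∈ B, t ∈ adjacent P u)
    (hneg : ∀ w, u w = 0 → w ≠ 0 → ∃ t ∈ B, t w < 0) :
    ({v ∈ vertices P | u v = 0}.ncard : ℤ) ≤ B.card * ((α : ℤ) - Module.finrank ℝ E + 1) := by
  classical
  have hfin : ∀ p : E → Prop, {v ∈ vertices P | p v}.Finite :=
    fun p => hP.finite_vertices.subset fun v hv => hv.1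
  have hcover : (hfin fun v => u v = 0).toFinset ⊆
      B.biUnion fun t => (hfin fun v => u v = 0 ∧ t v = -1).toFinset := by
    intro v hv
    rw [Set.Finite.mem_toFinset] at hv
    obtain ⟨t, ht, htv⟩ := hneg v hv.2 (hv0 v hv.1)
    rw [Finset.mem_biUnion]
    refine ⟨t, ht, ?_⟩
    rw [Set.Finite.mem_toFinset]
    refine ⟨hv.1, hv.2, ?_⟩
    have htU := (hB t ht).1
    have h1 := vertices_subset_dualPolytope htU v (extremePoints_subset hv.1)
    obtain ⟨k, hk⟩ := hint t htU v hv.1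
    rw [hk] at h1 htv ⊢
    have h2 : -1 ≤ k := by exact_mod_cast h1
    have h3 : k < 0 := by exact_mod_cast htv
    have : k = -1 := by omega
    rw [this]
    norm_num
  have hcard := (Finset.card_le_card hcover).trans Finset.card_biUnion_le
  rw [← Set.ncard_eq_toFinset_card _ (hfin fun v => u v = 0)] at hcard
  -- The common vertices span a hyperplane, so they number at least `d - 1` of the at most `α`
  -- vertices of the facet of `t`.
  have hterm : ∀ t ∈ B, ((hfin fun v => u v = 0 ∧ t v = -1).toFinset.card : ℤ) ≤
      (α : ℤ) - Module.finrank ℝ E + 1 := by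
    intro t ht
    obtain ⟨htU, hne, hspan⟩ := hB t ht
    have h1 := finrank_span_le_ncard (hfin fun v => u v = -1 ∧ t v = -1)
    rw [hspan] at h1
    have h2 := finrank_ker_add_one (sub_ne_zero.2 hne)
    have hdisj : Disjoint {v ∈ vertices P | u v = 0 ∧ t v = -1}
        {v ∈ vertices P | u v = -1 ∧ t v = -1} := by
      rw [Set.disjoint_left]
      rintro v ⟨-, h, -⟩ ⟨-, h', -⟩
      rw [h] at h'
      norm_num at h'
    have h3 := Set.ncard_union_eq hdisj (hfin _) (hfin _)
    have h4 : ({v ∈ vertices P | u v = 0 ∧ t v = -1} ∪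
        {v ∈ vertices P | u v = -1 ∧ t v = -1}).ncard ≤ {v ∈ vertices P | t v = -1}.ncard := by
      refine Set.ncard_le_ncard ?_ (hfin _)
      rintro v (⟨hv, -, h⟩ | ⟨hv, -, h⟩) <;> exact ⟨hv, h⟩
    have h5 := hα t htU
    rw [← Set.ncard_eq_toFinset_card _ (hfin fun v => u v = 0 ∧ t v = -1)]
    omega
  calc ({v ∈ vertices P | u v = 0}.ncard : ℤ)
      ≤ ∑ t ∈ B, ((hfin fun v => u v = 0 ∧ t v = -1).toFinset.card : ℤ) := by exact_mod_cast hcard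
    _ ≤ ∑ t ∈ B, ((α : ℤ) - Module.finrank ℝ E + 1) := Finset.sum_le_sum hterm
    _ = _ := by rw [Finset.sum_const, nsmul_eq_mul]

theorem exists_adjacent_subset_card_le {P : Set E} (hP : IsPolytope P) (h0 : (0 : E) ∈ P)
    (hD : IsPolytope (dualPolytope P)) {u : StrongDual ℝ E} (hu0 : u ≠ 0)
    (hu : u ∈ vertices (dualPolytope P)) :
    ∃ B : Finset (StrongDual ℝ E), (∀ t ∈ B, t ∈ adjacent P u) ∧
      (B.card : ℤ) ≤ 2 * ((Module.finrank ℝ E : ℤ) - 1) ∧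
      ∀ w, u w = 0 → w ≠ 0 → ∃ t ∈ B, t w < 0 := by
  have hfin : (adjacent P u).Finite := hD.finite_vertices.subset fun t ht => ht.1
  obtain ⟨B, hB, hcard, hneg⟩ := exists_subset_card_le_two_mul_finrank hfin.toFinset _
    (LinearMap.ker (u : E →ₗ[ℝ] ℝ)) rfl (by
      intro w hw hw0
      obtain ⟨t, ht, htw⟩ := exists_adjacent_neg hP h0 hD hu (w := w) hw hw0
      exact ⟨t, hfin.mem_toFinset.2 ht, htw⟩)
  have := finrank_ker_add_one hu0
  exact ⟨B, fun t ht => hfin.mem_toFinset.1 (hB ht), by omega, fun w hw => hneg w hw⟩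

end Counting

/-! ### Simplicial facets -/

section Simplices

variable {E : Type*} [NormedAddCommGroup E] [NormedSpace ℝ E]

/-- Applying `u` to a linear relation shows that its coefficients sum to zero. -/
theorem affineIndependent_iff_linearIndependent {ι : Type*} {z : ι → E} {u : StrongDual ℝ E}
    (hz : ∀ i, u (z i) = -1) : AffineIndependent ℝ z ↔ LinearIndependent ℝ z := by
  rw [affineIndependent_iff, linearIndependent_iff']
  refine ⟨fun h s w hw => h s w ?_ hw, fun h s w _ hw => h s w hw⟩
  have := congrArg u hw
  simpa [map_sum, hz] using this

variable [FiniteDimensional ℝ E]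

theorem isSimplex_dualFace_iff {P : Set E} (hP : IsPolytope P) {u : StrongDual ℝ E}
    (hu : u ∈ vertices (dualPolytope P)) :
    IsSimplex (dualFace P u) ↔ (vertices (dualFace P u)).ncard = Module.finrank ℝ E := by
  have huD := vertices_subset_dualPolytope hu
  have hF := hP.of_isExposed (isExposed_dualFace huD)
  have hspan : Submodule.span ℝ (vertices (dualFace P u)) = ⊤ := by
    rw [vertices_dualFace huD, span_eq_top_of_vertex_dual hP hu]
  have huv : ∀ v ∈ vertices (dualFace P u), u v = -1 := fun v hv => (extremePoints_subset hv).2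
  constructor
  · rintro ⟨S, hS, hFS⟩
    have hvS : vertices (dualFace P u) = S := by
      rw [hFS]
      exact vertices_convexHull_of_affineIndependent hS
    rw [hvS] at hspan huv ⊢
    have hli := (affineIndependent_iff_linearIndependent (u := u)
      (z := ((↑) : S → E)) fun i => huv i i.2).1 hS
    rw [Set.ncard_coe_finset, ← finrank_span_finset_eq_card hli, hspan, finrank_top]
  · intro hcard
    have hfin := hF.finite_vertices
    refine ⟨hfin.toFinset, ?_, by rw [hfin.coe_toFinset, hF.convexHull_vertices]⟩
    rw [affineIndependent_iff_linearIndependent (u := u)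
      (z := ((↑) : hfin.toFinset → E)) fun i => huv i (hfin.mem_toFinset.1 i.2)]
    rw [Set.ncard_eq_toFinset_card _ hfin] at hcard
    refine linearIndependent_of_top_le_span_of_card_eq_finrank ?_ (by simpa using hcard)
    rw [← hspan]
    exact Submodule.span_mono fun v hv => ⟨⟨v, hfin.mem_toFinset.2 hv⟩, rfl⟩

/-- Taking vertex sets matches the facets with the `(d-1)`-subsets of the `d` vertices. Those
vertices form a basis, so the functional that is `0` on a subset and `1` on the rest exposes the
corresponding face. -/
theorem ncard_facets_of_isSimplex_dualFace {P : Set E} (hP : IsPolytope P) [Nontrivial E]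
    {u : StrongDual ℝ E} (hu : u ∈ vertices (dualPolytope P)) (hs : IsSimplex (dualFace P u)) :
    (facets (dualFace P u)).ncard = Module.finrank ℝ E := by
  classical
  have hpos : 0 < Module.finrank ℝ E := Module.finrank_pos
  have huD := vertices_subset_dualPolytope hu
  have hF := hP.of_isExposed (isExposed_dualFace huD)
  have huF : ∀ x ∈ dualFace P u, u x = -1 := fun x hx => hx.2
  have hspan : Submodule.span ℝ (vertices (dualFace P u)) = ⊤ := by
    rw [vertices_dualFace huD, span_eq_top_of_vertex_dual hP hu]
  have hdim := finrank_span_eq_polyDim_add_one u huF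
  rw [← hF.span_vertices, hspan, finrank_top] at hdim
  have hcard := (isSimplex_dualFace_iff hP hu).1 hs
  obtain ⟨S, hS, hFS⟩ := hs
  set F := dualFace P u with hFdef
  have hvS : vertices F = S := by
    rw [hFS]
    exact vertices_convexHull_of_affineIndependent hS
  rw [hvS] at hspan hcard
  rw [Set.ncard_coe_finset] at hcard
  have hSF : ∀ s ∈ S, s ∈ F := fun s hs =>
    extremePoints_subset (𝕜 := ℝ) (show s ∈ vertices F by rw [hvS]; exact hs)
  have hli : LinearIndependent ℝ ((↑) : S → E) := (affineIndependent_iff_linearIndependent (u := u)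
      (z := ((↑) : S → E)) fun i => huF i (hSF i i.2)).1 hS
  have hlin : ∀ A ⊆ S, Module.finrank ℝ (Submodule.span ℝ (A : Set E)) = A.card := fun A hA =>
    finrank_span_finset_eq_card
      (LinearIndepOn.mono (v := id) (t := (A : Set E)) (s := (S : Set E)) hli hA)
  have himage : vertices '' facets F =
      (fun A : Finset E => (A : Set E)) '' (S.powersetCard (Module.finrank ℝ E - 1) : Set _) := by
    ext A
    constructor
    · rintro ⟨R, hR, rfl⟩
      have hRP := hF.of_isExposed hR.1
      have hsub : hRP.finite_vertices.toFinset ⊆ S := by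
        intro v hv
        rw [Set.Finite.mem_toFinset, vertices_of_isExposed hR.1, hvS] at hv
        exact hv.2
      refine ⟨hRP.finite_vertices.toFinset, ?_, by simp⟩
      rw [Finset.mem_coe, Finset.mem_powersetCard]
      refine ⟨hsub, ?_⟩
      have h1 := finrank_span_eq_polyDim_add_one u fun x hx => huF x (hR.1.subset hx)
      have h2 := hR.2
      rw [← hRP.span_vertices] at h1
      have h3 := hlin _ hsub
      rw [Set.Finite.coe_toFinset] at h3
      omega
    · rintro ⟨A, hA, rfl⟩
      rw [Finset.mem_coe, Finset.mem_powersetCard] at hA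
      let b := Module.Basis.mk hli (by rw [Subtype.range_coe_subtype]; exact hspan.ge)
      let f : StrongDual ℝ E := LinearMap.toContinuousLinearMap
        (b.constr ℝ fun s : S => if (s : E) ∈ A then (0 : ℝ) else 1)
      have hf : ∀ s ∈ S, f s = if s ∈ A then 0 else 1 := by
        intro s hs
        have h1 : b ⟨s, hs⟩ = s := by simp [b]
        have h2 := b.constr_basis ℝ (fun s : S => if (s : E) ∈ A then (0 : ℝ) else 1) ⟨s, hs⟩
        rw [h1] at h2
        exact h2
      have hf0 : ∀ x ∈ F, 0 ≤ f x := by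
        intro x hx
        rw [hFS] at hx
        refine convexHull_min (t := {x | 0 ≤ f x}) ?_
          (convex_halfSpace_ge f.toLinearMap.isLinear _) hx
        intro s hs
        show 0 ≤ f s
        rw [hf s hs]
        split_ifs <;> norm_num
      have hexp : IsExposed ℝ F {x ∈ F | f x = 0} := isExposed_sep f 0 hf0
      have hvA : vertices {x ∈ F | f x = 0} = A := by
        rw [vertices_of_isExposed hexp, hvS]
        ext x
        constructor
        · rintro ⟨⟨-, hx⟩, hxS⟩
          rw [hf x hxS] at hx
          by_contra hxA
          rw [if_neg (by simpa using hxA)] at hx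
          norm_num at hx
        · intro hx
          have hxS := hA.1 hx
          exact ⟨⟨hSF x hxS, by rw [hf x hxS, if_pos (by simpa using hx)]⟩, hxS⟩
      refine ⟨_, ⟨hexp, ?_⟩, hvA⟩
      have h1 := finrank_span_eq_polyDim_add_one (F := {x ∈ F | f x = 0}) u fun x hx => huF x hx.1
      rw [← (hF.of_isExposed hexp).span_vertices, hvA, hlin A hA.1] at h1
      omega
  have hinj : Set.InjOn vertices (facets F) := by
    intro R hR R' hR' h
    rw [← (hF.of_isExposed hR.1).convexHull_vertices,
      ← (hF.of_isExposed hR'.1).convexHull_vertices]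
    exact congrArg _ h
  rw [← hinj.ncard_image, himage,
    Set.ncard_image_of_injective _ Finset.coe_injective, Set.ncard_coe_finset,
    Finset.card_powersetCard, hcard]
  obtain ⟨n, hn⟩ : ∃ n, Module.finrank ℝ E = n + 1 := ⟨_, (Nat.sub_add_cancel hpos).symm⟩
  rw [hn, Nat.add_sub_cancel, Nat.choose_succ_self_right]

end Simplices

/-! ### Bounds for reflexive polytopes -/

section Main

variable {E : Type*} [NormedAddCommGroup E] [NormedSpace ℝ E]

theorem IsReflexive.vertex_ne_zero {M : Submodule ℤ E} {P : Set E} (hP : IsReflexive M P) :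
    ∀ v ∈ vertices P, v ≠ 0 := by
  rintro v hv rfl
  have := (hP.isFano.primitive 0 hv).2 0 (zero_mem _) 2 (by simp)
  omega

theorem IsReflexive.nontrivial {M : Submodule ℤ E} {P : Set E} (hP : IsReflexive M P) :
    Nontrivial E := by
  obtain ⟨v, hv⟩ := hP.isFano.isLatticePolytope.1.isCompact.extremePoints_nonempty
    ⟨0, interior_subset hP.isFano.zero_mem_interior⟩
  exact ⟨v, 0, hP.vertex_ne_zero v hv⟩

variable [FiniteDimensional ℝ E]

/-- The two bounds on the number of vertices, through `2 * (d - 1)` adjacent facets and through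
all the facets adjacent to a suitable facet. -/
theorem IsReflexive.ncard_vertices_le {M : Submodule ℤ E} {P : Set E} (hP : IsReflexive M P) :
    Module.finrank ℝ E ≤ maxFacetVertices P ∧
    ((vertices P).ncard : ℤ) ≤ 2 * maxFacetVertices P +
      2 * ((Module.finrank ℝ E : ℤ) - 1) * ((maxFacetVertices P : ℤ) - Module.finrank ℝ E + 1) ∧
    ((vertices P).ncard : ℤ) ≤ 2 * maxFacetVertices P +
      ((maxFacetVertices P : ℤ) - Module.finrank ℝ E + 1) * maxFacetFacets P := by
  have hnt := hP.nontrivial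
  have hpol := hP.isFano.isLatticePolytope.1
  have hD := hP.dual_isLatticePolytope.1
  have h0 : (0 : E) ∈ P := interior_subset hP.isFano.zero_mem_interior
  have hfac := facets_eq_image hpol hP.isFano.zero_mem_interior
  have hint : ∀ t ∈ vertices (dualPolytope P), ∀ v ∈ vertices P, ∃ k : ℤ, t v = k :=
    fun t ht v hv => hP.dual_isLatticePolytope.2 ht v (hP.isFano.isLatticePolytope.2 hv)
  have hα : ∀ t ∈ vertices (dualPolytope P),
      {v ∈ vertices P | t v = -1}.ncard ≤ maxFacetVertices P := by
    intro t ht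
    rw [← vertices_dualFace (vertices_subset_dualPolytope ht)]
    exact ncard_vertices_facet_le hpol (hfac ▸ ⟨t, ht, rfl⟩)
  obtain ⟨u, hu, hsum⟩ := exists_vertex_dual_nonpos hD (∑ v ∈ hpol.finite_vertices.toFinset, v)
  have hspan := span_eq_top_of_vertex_dual hpol hu
  have hd : Module.finrank ℝ E ≤ maxFacetVertices P := by
    have := finrank_span_le_ncard (hpol.finite_vertices.subset fun v hv => hv.1 :
      {v ∈ vertices P | u v = -1}.Finite)
    rw [hspan, finrank_top] at this
    exact this.trans (hα u hu)
  have hu0 : u ≠ 0 := by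
    rintro rfl
    have : {v ∈ vertices P | (0 : StrongDual ℝ E) v = -1} = ∅ := by
      ext v
      simp
    rw [this, Submodule.span_empty] at hspan
    exact bot_ne_top hspan
  have hn := ncard_vertices_le_of_sum_nonpos hpol (vertices_subset_dualPolytope hu)
    (hint u hu) hsum
  have hαu := hα u hu
  have hnn : 0 ≤ (maxFacetVertices P : ℤ) - Module.finrank ℝ E + 1 := by omega
  refine ⟨hd, ?_, ?_⟩
  · obtain ⟨B, hB, hcard, hneg⟩ := exists_adjacent_subset_card_le hpol h0 hD hu0 hu
    have h1 := ncard_level_zero_le hpol hint hP.vertex_ne_zero hα B hB hneg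
    have h2 := mul_le_mul_of_nonneg_right hcard hnn
    omega
  · have hfin : (adjacent P u).Finite := hD.finite_vertices.subset fun t ht => ht.1
    have h1 := ncard_level_zero_le hpol hint hP.vertex_ne_zero hα hfin.toFinset
      (fun t ht => hfin.mem_toFinset.1 ht) (fun w hw hw0 => by
        obtain ⟨t, ht, htw⟩ := exists_adjacent_neg hpol h0 hD hu hw hw0
        exact ⟨t, hfin.mem_toFinset.2 ht, htw⟩)
    rw [← Set.ncard_eq_toFinset_card _ hfin] at h1
    have hβ : (adjacent P u).ncard ≤ maxFacetFacets P :=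
      (ncard_adjacent_le_ncard_facets hpol hu).trans
        (ncard_facets_facet_le hpol (hfac ▸ ⟨u, hu, rfl⟩))
    have h2 := mul_le_mul_of_nonneg_right (Int.ofNat_le.2 hβ) hnn
    rw [mul_comm (maxFacetVertices P - Module.finrank ℝ E + 1 : ℤ)]
    have h3 : ((vertices P).ncard : ℤ) ≤ 2 * {v ∈ vertices P | u v = -1}.ncard +
      {v ∈ vertices P | u v = 0}.ncard := by exact_mod_cast hn
    have h4 : ({v ∈ vertices P | u v = -1}.ncard : ℤ) ≤ maxFacetVertices P := by
      exact_mod_cast hαu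
    exact h3.trans (add_le_add (by linarith) (h1.trans h2))

theorem IsReflexive.facets_nonempty {M : Submodule ℤ E} {P : Set E} (hP : IsReflexive M P) :
    (facets P).Nonempty := by
  have hnt := hP.nontrivial
  obtain ⟨u, hu, -⟩ := exists_vertex_dual_nonpos hP.dual_isLatticePolytope.1 (0 : E)
  rw [facets_eq_image hP.isFano.isLatticePolytope.1 hP.isFano.zero_mem_interior]
  exact ⟨_, u, hu, rfl⟩

/-- Every facet has at least `d` vertices, with equality exactly for simplices. -/
theorem IsReflexive.isSimplicial_iff {M : Submodule ℤ E} {P : Set E} (hP : IsReflexive M P) :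
    IsSimplicial P ↔ maxFacetVertices P = Module.finrank ℝ E := by
  have hnt := hP.nontrivial
  have hpol := hP.isFano.isLatticePolytope.1
  have hfac := facets_eq_image hpol hP.isFano.zero_mem_interior
  constructor
  · intro hs
    refine maxFacetVertices_eq hpol hP.facets_nonempty fun F hF => ?_
    have hsF := hs F hF
    rw [hfac] at hF
    obtain ⟨u, hu, rfl⟩ := hF
    exact (isSimplex_dualFace_iff hpol hu).1 hsF
  · intro h F hF
    have h1 := ncard_vertices_facet_le hpol hF
    rw [hfac] at hF
    obtain ⟨u, hu, rfl⟩ := hF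
    have huD := vertices_subset_dualPolytope hu
    refine (isSimplex_dualFace_iff hpol hu).2 (le_antisymm (h1.trans h.le) ?_)
    have h2 := finrank_span_le_ncard (hpol.of_isExposed (isExposed_dualFace huD)).finite_vertices
    rwa [vertices_dualFace huD, span_eq_top_of_vertex_dual hpol hu, finrank_top,
      ← vertices_dualFace huD] at h2

theorem IsReflexive.maxFacetFacets_of_isSimplicial {M : Submodule ℤ E} {P : Set E}
    (hP : IsReflexive M P) (hs : IsSimplicial P) : maxFacetFacets P = Module.finrank ℝ E := by
  have hnt := hP.nontrivial
  have hpol := hP.isFano.isLatticePolytope.1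
  have hfac := facets_eq_image hpol hP.isFano.zero_mem_interior
  refine maxFacetFacets_eq hpol hP.facets_nonempty fun F hF => ?_
  have hsF := hs F hF
  rw [hfac] at hF
  obtain ⟨u, hu, rfl⟩ := hF
  exact ncard_facets_of_isSimplex_dualFace hpol hu hsF

end Main

end ReflexivePolytope

/-! ### Arithmetic deduction of the stated bounds -/

theorem theorem5p3 {E : Type*} [NormedAddCommGroup E] [NormedSpace ℝ E] [FiniteDimensional ℝ E]
    (M : Submodule ℤ E) [DiscreteTopology M] [IsZLattice ℝ M]
    (d : ℕ) (hd : Module.finrank ℝ E = d)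
    (P : Set E) (hP : ReflexivePolytope.IsReflexive M P)
    (α β : ℕ) (hα : α = ReflexivePolytope.maxFacetVertices P)
    (hβ : β = ReflexivePolytope.maxFacetFacets P) :
    -- first bound, its two refinements, and the simplicial case
    ((ReflexivePolytope.vertices P).ncard ≤ 2 * d * α ∧
      (2 * (d : ℤ) - 3 ≤ α →
        ((ReflexivePolytope.vertices P).ncard : ℤ) ≤ 2 * d * ((α : ℤ) - d + 2) - 2) ∧
      ((α : ℤ) ≤ 2 * d - 3 →
        ((ReflexivePolytope.vertices P).ncard : ℤ) ≤ (d : ℤ) * α + α - d + 1) ∧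
      (ReflexivePolytope.IsSimplicial P ↔ α = d) ∧
      (ReflexivePolytope.IsSimplicial P → 3 ≤ d →
        (ReflexivePolytope.vertices P).ncard ≤ d ^ 2 + 1)) ∧
    -- second bound and its simplicial case
    (((ReflexivePolytope.vertices P).ncard : ℝ) ≤
        ((α : ℝ) - d + 1) * β + 2 +
          2 * √(((α : ℝ) - 1) * ((d : ℝ) + 1) *
            (((α : ℝ) - 1) + ((α : ℝ) - d + 1) * β)) ∧
      (ReflexivePolytope.IsSimplicial P → β = d) ∧
      (ReflexivePolytope.IsSimplicial P →
        ((ReflexivePolytope.vertices P).ncard : ℝ) ≤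
          (d : ℝ) + 2 + 2 * √(((d : ℝ) ^ 2 - 1) * (2 * (d : ℝ) - 1)))) := by
  have hnt := hP.nontrivial
  have hpos : 0 < Module.finrank ℝ E := Module.finrank_pos
  obtain ⟨hdα, h1, h2⟩ := hP.ncard_vertices_le
  have hiff := hP.isSimplicial_iff
  have hβs := hP.maxFacetFacets_of_isSimplicial
  rw [← hα, hd] at hdα h1 h2 hiff
  rw [hd] at hpos
  rw [← hβ, hd] at hβs
  rw [← hβ] at h2
  generalize (ReflexivePolytope.vertices P).ncard = n at h1 h2 ⊢
  -- The radicand is at least `(α - 1)²`, so `2α = 2 + 2(α - 1)` is absorbed by the square-root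
  -- expression.
  have hbound : ∀ e : ℝ, 0 ≤ e → (α : ℝ) - 1 ≤
      √(((α : ℝ) - 1) * ((d : ℝ) + 1) * (((α : ℝ) - 1) + e)) := by
    intro e he
    have h1α : (1 : ℝ) ≤ α := by exact_mod_cast (show 1 ≤ α by omega)
    have hd0 : (0 : ℝ) ≤ d := by positivity
    apply Real.le_sqrt_of_sq_le
    have h3 : 0 ≤ ((α : ℝ) - 1) * e := mul_nonneg (by linarith) he
    have h4 : 0 ≤ (d : ℝ) * (((α : ℝ) - 1) * ((α : ℝ) - 1)) :=
      mul_nonneg hd0 (mul_self_nonneg _)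
    have h5 : 0 ≤ (d : ℝ) * (((α : ℝ) - 1) * e) := mul_nonneg hd0 h3
    nlinarith
  have h2R : (n : ℝ) ≤ 2 * α + ((α : ℝ) - d + 1) * β := by exact_mod_cast h2
  have hsimp : ReflexivePolytope.IsSimplicial P → (n : ℤ) ≤ 3 * d := by
    intro hs
    rw [hiff.1 hs, hβs hs] at h2
    linarith
  have hdα' : (d : ℤ) ≤ α := by exact_mod_cast hdα
  have hd1 : (1 : ℤ) ≤ d := by exact_mod_cast hpos
  refine ⟨⟨?_, fun _ => by linarith, fun h => ?_, hiff, fun hs h3 => ?_⟩, ?_, hβs, fun hs => ?_⟩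
  · have : (n : ℤ) ≤ 2 * d * α := by nlinarith
    exact_mod_cast this
  -- This product is exactly the claimed bound minus `2α + 2(d-1)(α-d+1)`.
  · have : 0 ≤ ((d : ℤ) - 1) * (2 * d - 3 - α) := mul_nonneg (by linarith) (by linarith)
    linarith
  · have h4 := hsimp hs
    have : (n : ℤ) ≤ d ^ 2 + 1 := by nlinarith
    exact_mod_cast this
  · have h3 : (0 : ℝ) ≤ ((α : ℝ) - d + 1) * β := by
      have : (d : ℝ) ≤ α := by exact_mod_cast hdα
      exact mul_nonneg (by linarith) (by positivity)
    linarith [hbound _ h3]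
  · have h4 : (n : ℝ) ≤ 3 * d := by exact_mod_cast hsimp hs
    have h5 := hbound d (by positivity)
    rw [hiff.1 hs] at h5
    rw [show ((d : ℝ) ^ 2 - 1) * (2 * d - 1) = ((d : ℝ) - 1) * (d + 1) * ((d - 1) + d) by ring]
    linarith
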